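/- Let $d\ge 1$ and let $\Delta$ be the set of probability distributions on $\mathbb{R}^d$ with $\int\|x\|^2F(dx)<\infty$ (the case $d=1$ is that of real observations). Give $\Delta$ the topology in which $F\to\Phi$ means $\int\gamma\,dF\to\int\gamma\,d\Phi$ for every continuous $\gamma:\mathbb{R}^d\to\mathbb{R}$ such that $\gamma(x)/(1+\|x\|^2)$ is bounded, that is, the coarsest topology for which all the maps $F\mapsto\int\gamma\,dF$ are continuous (the Wasserstein-2 topology), and let $$\rho_2(\mu,\nu)=\Bigl(\inf_{\pi}\int\|x-y\|^2\,\pi(dx,dy)\Bigr)^{1/2}$$ be the Wasserstein metric, the infimum being over all couplings $\pi$ of $\mu$ and $\nu$. Let $\Delta_0$ be a fixed compact subset of $\Delta$ and let $(F_n)$ be any sequence in $\Delta_0$. For each $n$ let $X_{n,1},\dots,X_{n,n}$ be independent with distribution $F_n$ (on a probability space that may depend on $n$). Let $\delta$ be a fixed real number and let $m_n=(m_{n,1},\dots,m_{n,n})\in\mathbb{R}^n$ be an arbitrary sequence of non-random vectors satisfying $\sum_i m_{n,i}=0$ and $\sum_i m_{n,i}^2\le\delta^2$ for all $n$. Let $\hat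 F_n=\frac1n\sum_i\delta_{X_{n,i}}$ be the empirical distribution of $X_{n,1},\dots,X_{n,n}$ (here $\delta_x$ is the unit mass at $x$). Let $\mathcal{L}_{F_n}$ be the law of $\sum_i m_{n,i}X_{n,i}$, and let $\mathcal{L}_{\hat F_n}$ be the conditional law, given $X_{n,1},\dots,X_{n,n}$, of $\sum_i m_{n,i}X^*_{n,i}$, where $X^*_{n,1},\dots,X^*_{n,n}$ are, given $X_{n,1},\dots,X_{n,n}$, independent with distribution $\hat F_n$. Then $\rho_2(\mathcal{L}_{F_n},\mathcal{L}_{\hat F_n})\to 0$ in probability as $n\to\infty$; that is, for every $\varepsilon>0$ the probability that $\rho_2(\mathcal{L}_{F_n},\mathcal{L}_{\hat F_n})\ge\varepsilon$ tends to $0$. -/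

import Mathlib

open MeasureTheory ProbabilityTheory Filter Topology
open scoped ENNReal

noncomputable section

/-- The probability distributions on `E` with finite second moment. -/
structure FinVarDist (E : Type*) [NormedAddCommGroup E] [MeasurableSpace E] where
  /-- The underlying measure. -/
  toMeasure : Measure E
  isProbabilityMeasure : IsProbabilityMeasure toMeasure
  memLp_two : MemLp (fun x : E => x) 2 toMeasure

/-- The continuous real functions `γ` on `E` for which `γ(x) / (1 + ‖x‖²)` is bounded. -/
def QuadGrowth (E : Type*) [NormedAddCommGroup E] : Type _ :=
  {γ : E → ℝ // Continuous γ ∧ ∃ C : ℝ, ∀ x, |γ x| ≤ C * (1 + ‖x‖ ^ 2)}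

/-- The topology on the distributions with finite second moment in which `F` converges to `Φ`
if and only if `E_F γ(X)` converges to `E_Φ γ(X)` for each continuous `γ` with
`γ(x) / (1 + ‖x‖²)` bounded. -/
instance FinVarDist.instTopologicalSpace (E : Type*) [NormedAddCommGroup E] [MeasurableSpace E] :
    TopologicalSpace (FinVarDist E) :=
  TopologicalSpace.induced
    (fun (F : FinVarDist E) (γ : QuadGrowth E) => ∫ x, γ.1 x ∂F.toMeasure) inferInstance

/-- `π` is a coupling of `μ` and `ν`: a measure on the product with marginals `μ` and `ν`. -/
def IsCoupling {E : Type*} [MeasurableSpace E] (π : Measure (E × E)) (μ ν : Measure E) : Prop :=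
  π.map Prod.fst = μ ∧ π.map Prod.snd = ν

/-- The Wasserstein metric of order two,
`ρ₂(μ, ν) = (inf E ‖U - V‖²) ^ (1/2)`, the infimum being over all couplings `(U, V)` of
`μ` and `ν`. It takes values in `[0, ∞]` and is finite on distributions with finite
second moment. -/
def rho2 {E : Type*} [NormedAddCommGroup E] [MeasurableSpace E] (μ ν : Measure E) : ℝ≥0∞ :=
  (⨅ (π : Measure (E × E)) (_ : IsCoupling π μ ν), ∫⁻ z, ‖z.1 - z.2‖ₑ ^ 2 ∂π) ^ (1 / 2 : ℝ)

/-- The empirical distribution of the points `x₁, …, xₙ`, with mass `1 / n` at each of them. -/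
def empiricalDist {E : Type*} [MeasurableSpace E] {n : ℕ} (x : Fin n → E) : Measure E :=
  (n : ℝ≥0∞)⁻¹ • ∑ i, Measure.dirac (x i)

/-- The bootstrap law: the law of `∑ mᵢ Xᵢ*`, where `X₁*, …, Xₙ*` are independent and distributed
according to the empirical distribution of the points `x₁, …, xₙ`. -/
def bootstrapLaw {E : Type*} [NormedAddCommGroup E] [NormedSpace ℝ E] [MeasurableSpace E] {n : ℕ}
    (m : Fin n → ℝ) (x : Fin n → E) : Measure E :=
  (Measure.pi fun _ : Fin n => empiricalDist x).map fun y => ∑ i, m i • y i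

end

/-!
A coupling `(U, V)` of `μ` and `ν`, copied independently `n` times, couples the laws of
`∑ mᵢ Uᵢ` and `∑ mᵢ Vᵢ`. Because `∑ mᵢ = 0`, the difference `∑ mᵢ (Uᵢ - Vᵢ)` is centred, and its
second moment is at most `(∑ mᵢ²) E ‖U - V‖² ≤ δ² E ‖U - V‖²` (`rho2_map_sum_smul_sq_le`). So it
suffices that `Fₙ` and the empirical distribution have a coupling whose cost is small in
probability.

Such a coupling is built by hand. Partition a large ball into finitely many cells of small diameter.
The mass that two distributions share on a cell is coupled within the cell; the rest is coupled
independently, and its cost is controlled by the deviations between the masses of the cells and by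
the second moments outside the ball (`exists_isCoupling_le_of_partition`). By compactness of `Δ₀`,
the ball can be chosen so that the second moment outside it is small for all `Fₙ` at once
(`exists_forall_lintegral_tail_le`), and then also for the empirical distributions in expectation.
For a fixed partition, the deviation of each cell mass has expectation at most `2 / √n` for every
`Fₙ` (`lintegral_empiricalDist_deviation_le`). Markov's inequality concludes.
-/

/-! ### Transport cost of weighted sums -/

/-- The second moment of `∑ mᵢ f(zᵢ)` for independent identically distributed `zᵢ`: as `∑ mᵢ = 0`
the sum is centred, so that its second moment is its variance `(∑ mᵢ²) Var f`. -/
theorem lintegral_ofReal_sq_sum_mul_le {Z : Type*} [MeasurableSpace Z] {κ : Measure Z}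
    [IsProbabilityMeasure κ] {f : Z → ℝ} (hf : MemLp f 2 κ) {n : ℕ} {m : Fin n → ℝ} {δ : ℝ}
    (hmean : ∑ i, m i = 0) (hsq : ∑ i, m i ^ 2 ≤ δ ^ 2) :
    ∫⁻ z, ENNReal.ofReal ((∑ i, m i * f (z i)) ^ 2) ∂(Measure.pi fun _ : Fin n => κ)
      ≤ ENNReal.ofReal (δ ^ 2) * ∫⁻ z, ENNReal.ofReal (f z ^ 2) ∂κ := by
  have hmp : ∀ i : Fin n, MeasurePreserving (fun z : Fin n → Z => z i)
      (Measure.pi fun _ : Fin n => κ) κ := fun i => measurePreserving_eval (fun _ => κ) i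
  have hfi : ∀ i : Fin n, MemLp (fun z : Fin n → Z => f (z i)) 2 (Measure.pi fun _ => κ) :=
    fun i => hf.comp_measurePreserving (hmp i)
  have hsum : MemLp (fun z : Fin n → Z => ∑ i, m i * f (z i)) 2 (Measure.pi fun _ => κ) :=
    memLp_finsetSum _ fun i _ => (hfi i).const_mul (m i)
  have hint : ∫ z, ∑ i, m i * f (z i) ∂(Measure.pi fun _ : Fin n => κ) = 0 := by
    rw [integral_finsetSum _ fun i _ => ((hfi i).const_mul (m i)).integrable one_le_two]
    have : ∀ i : Fin n, ∫ z, m i * f (z i) ∂(Measure.pi fun _ : Fin n => κ)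
        = m i * ∫ z, f z ∂κ := fun i => by
      have h := integral_map (hmp i).aemeasurable (f := f)
        (by rw [(hmp i).map_eq]; exact hf.aestronglyMeasurable)
      rw [(hmp i).map_eq] at h
      rw [integral_const_mul, h]
    simp_rw [this, ← Finset.sum_mul, hmean, zero_mul]
  have hvar : ∫ z, (∑ i, m i * f (z i)) ^ 2 ∂(Measure.pi fun _ : Fin n => κ)
      = (∑ i, m i ^ 2) * Var[f; κ] := by
    rw [← variance_of_integral_eq_zero hsum.aemeasurable hint]
    have := variance_sum_pi (μ := fun _ : Fin n => κ) (X := fun i z => m i * f z)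
      (fun i => hf.const_mul (m i))
    rw [Finset.sum_mul]
    convert this using 2
    · ext z; simp
    · rw [variance_const_mul]
  rw [← ofReal_integral_eq_lintegral_ofReal hsum.integrable_sq (ae_of_all _ fun _ => sq_nonneg _),
    ← ofReal_integral_eq_lintegral_ofReal hf.integrable_sq (ae_of_all _ fun _ => sq_nonneg _),
    ← ENNReal.ofReal_mul (sq_nonneg _), hvar]
  refine ENNReal.ofReal_le_ofReal (mul_le_mul hsq ?_ (variance_nonneg _ _) (sq_nonneg _))
  exact variance_le_expectation_sq hf.aestronglyMeasurable

theorem lintegral_enorm_sq_sum_smul_le {E : Type*} [NormedAddCommGroup E] [InnerProductSpace ℝ E]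
    [FiniteDimensional ℝ E] [MeasurableSpace E] [BorelSpace E]
    {Z : Type*} [MeasurableSpace Z] {κ : Measure Z} [IsProbabilityMeasure κ]
    {V : Z → E} (hVm : Measurable V) (hV : MemLp V 2 κ) {n : ℕ} {m : Fin n → ℝ} {δ : ℝ}
    (hmean : ∑ i, m i = 0) (hsq : ∑ i, m i ^ 2 ≤ δ ^ 2) :
    ∫⁻ z, ‖∑ i, m i • V (z i)‖ₑ ^ 2 ∂(Measure.pi fun _ : Fin n => κ)
      ≤ ENNReal.ofReal (δ ^ 2) * ∫⁻ z, ‖V z‖ₑ ^ 2 ∂κ := by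
  let b := stdOrthonormalBasis ℝ E
  have hnorm : ∀ x : E, ‖x‖ₑ ^ 2 = ∑ j, ENNReal.ofReal (inner ℝ (b j) x ^ 2) := fun x => by
    rw [← ofReal_norm, ← ENNReal.ofReal_pow (norm_nonneg _),
      ← ENNReal.ofReal_sum_of_nonneg fun _ _ => sq_nonneg _, ← b.sum_sq_norm_inner_right x]
    simp
  have hin : ∀ j, Measurable fun x : E => inner ℝ (b j) x := fun j =>
    (continuous_const.inner continuous_id).measurable
  have hVi : ∀ i : Fin n, Measurable fun z : Fin n → Z => V (z i) := fun i =>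
    hVm.comp (measurable_pi_apply i)
  simp_rw [hnorm]
  have h1 : ∀ j, Measurable fun z => ENNReal.ofReal (inner ℝ (b j) (V z) ^ 2) := fun j =>
    (((hin j).comp hVm).pow_const 2).ennreal_ofReal
  have h2 : ∀ j, Measurable fun z : Fin n → Z =>
      ENNReal.ofReal (inner ℝ (b j) (∑ i, m i • V (z i)) ^ 2) := fun j =>
    (((hin j).comp
      (Finset.measurable_sum _ fun i _ => (hVi i).const_smul (m i))).pow_const 2).ennreal_ofReal
  rw [lintegral_finsetSum _ fun j _ => h1 j, lintegral_finsetSum _ fun j _ => h2 j,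
    Finset.mul_sum]
  refine Finset.sum_le_sum fun j _ => ?_
  simp_rw [inner_sum, inner_smul_right]
  exact lintegral_ofReal_sq_sum_mul_le (f := fun z => inner ℝ (b j) (V z))
    (hV.const_inner (b j)) hmean hsq

/-- Independent copies of a coupling of `μ` and `ν` couple the laws of the weighted sums, at a
cost at most `δ²` times that of the given coupling. -/
theorem rho2_map_sum_smul_sq_le {E : Type*} [NormedAddCommGroup E] [InnerProductSpace ℝ E]
    [FiniteDimensional ℝ E] [MeasurableSpace E] [BorelSpace E]
    {μ ν : Measure E} [IsProbabilityMeasure μ] [IsProbabilityMeasure ν]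
    {κ : Measure (E × E)} (hκ : IsCoupling κ μ ν)
    (hfin : ∫⁻ z, ‖z.1 - z.2‖ₑ ^ 2 ∂κ ≠ ∞) {n : ℕ} {m : Fin n → ℝ} {δ : ℝ}
    (hmean : ∑ i, m i = 0) (hsq : ∑ i, m i ^ 2 ≤ δ ^ 2) :
    rho2 ((Measure.pi fun _ : Fin n => μ).map fun y => ∑ i, m i • y i)
        ((Measure.pi fun _ : Fin n => ν).map fun y => ∑ i, m i • y i) ^ 2
      ≤ ENNReal.ofReal (δ ^ 2) * ∫⁻ z, ‖z.1 - z.2‖ₑ ^ 2 ∂κ := by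
  have : IsProbabilityMeasure κ := ⟨by
    rw [← Set.preimage_univ (f := Prod.fst), ← Measure.map_apply measurable_fst MeasurableSet.univ,
      hκ.1, measure_univ]⟩
  have hS : Measurable fun y : Fin n → E => ∑ i, m i • y i :=
    Finset.measurable_sum _ fun i _ => (measurable_pi_apply i).const_smul (m i)
  have hfst : (Measure.pi fun _ : Fin n => κ).map (fun z i => (z i).1)
      = Measure.pi fun _ : Fin n => μ := by
    rw [Measure.pi_map_pi (μ := fun _ : Fin n => κ) (f := fun _ z => z.1)
      (fun _ => measurable_fst.aemeasurable), hκ.1]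
  have hsnd : (Measure.pi fun _ : Fin n => κ).map (fun z i => (z i).2)
      = Measure.pi fun _ : Fin n => ν := by
    rw [Measure.pi_map_pi (μ := fun _ : Fin n => κ) (f := fun _ z => z.2)
      (fun _ => measurable_snd.aemeasurable), hκ.2]
  have m1 : Measurable fun (z : Fin n → E × E) (i : Fin n) => (z i).1 := by fun_prop
  have m2 : Measurable fun (z : Fin n → E × E) (i : Fin n) => (z i).2 := by fun_prop
  have hT : Measurable fun z : Fin n → E × E => (∑ i, m i • (z i).1, ∑ i, m i • (z i).2) :=
    (hS.comp m1).prodMk (hS.comp m2)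
  have hV : MemLp (fun z : E × E => z.1 - z.2) 2 κ := by
    refine ⟨(measurable_fst.sub measurable_snd).aestronglyMeasurable, ?_⟩
    rw [eLpNorm_lt_top_iff_lintegral_rpow_enorm_lt_top two_ne_zero ENNReal.ofNat_ne_top]
    simpa using hfin.lt_top
  rw [rho2, ← ENNReal.rpow_natCast, ← ENNReal.rpow_mul]
  norm_num only [Nat.cast_ofNat]
  rw [ENNReal.rpow_one]
  have hc : IsCoupling ((Measure.pi fun _ : Fin n => κ).map
      fun z => (∑ i, m i • (z i).1, ∑ i, m i • (z i).2))
      ((Measure.pi fun _ : Fin n => μ).map fun y => ∑ i, m i • y i)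
      ((Measure.pi fun _ : Fin n => ν).map fun y => ∑ i, m i • y i) := by
    constructor
    · rw [Measure.map_map measurable_fst hT, ← hfst, Measure.map_map hS m1]; rfl
    · rw [Measure.map_map measurable_snd hT, ← hsnd, Measure.map_map hS m2]; rfl
  refine (iInf₂_le (f := fun π (_ : IsCoupling π _ _) => ∫⁻ z, ‖z.1 - z.2‖ₑ ^ 2 ∂π) _ hc).trans ?_
  rw [lintegral_map (by fun_prop) hT]
  simp_rw [← Finset.sum_sub_distrib, ← smul_sub]
  exact lintegral_enorm_sq_sum_smul_le (measurable_fst.sub measurable_snd) hV hmean hsq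

/-! ### Couplings from a finite partition -/

theorem lintegral_enorm_sub_sq_prod_le {E : Type*} [NormedAddCommGroup E] [MeasurableSpace E]
    [BorelSpace E] [SecondCountableTopology E] (μ ν : Measure E) [IsFiniteMeasure μ]
    [IsFiniteMeasure ν] :
    ∫⁻ z, ‖z.1 - z.2‖ₑ ^ 2 ∂(μ.prod ν)
      ≤ 2 * (ν Set.univ * ∫⁻ x, ‖x‖ₑ ^ 2 ∂μ + μ Set.univ * ∫⁻ y, ‖y‖ₑ ^ 2 ∂ν) := by
  have hpt : ∀ x y : E, ‖x - y‖ₑ ^ 2 ≤ 2 * (‖x‖ₑ ^ 2 + ‖y‖ₑ ^ 2) := fun x y => by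
    have h : ‖x - y‖ ^ 2 ≤ 2 * (‖x‖ ^ 2 + ‖y‖ ^ 2) := by
      have := norm_sub_le x y
      nlinarith [sq_nonneg (‖x‖ - ‖y‖), norm_nonneg (x - y), norm_nonneg x, norm_nonneg y]
    simp_rw [← ofReal_norm, ← ENNReal.ofReal_pow (norm_nonneg _)]
    rw [← ENNReal.ofReal_add (by positivity) (by positivity), ← ENNReal.ofReal_ofNat,
      ← ENNReal.ofReal_mul (by positivity)]
    exact ENNReal.ofReal_le_ofReal h
  have hm : Measurable fun x : E => ‖x‖ₑ ^ 2 := by fun_prop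
  have h1 : ∫⁻ z, ‖z.1‖ₑ ^ 2 ∂(μ.prod ν) = ν Set.univ * ∫⁻ x, ‖x‖ₑ ^ 2 ∂μ := by
    rw [← lintegral_map (f := fun x : E => ‖x‖ₑ ^ 2) hm measurable_fst, Measure.map_fst_prod,
      lintegral_smul_measure, smul_eq_mul]
  have h2 : ∫⁻ z, ‖z.2‖ₑ ^ 2 ∂(μ.prod ν) = μ Set.univ * ∫⁻ y, ‖y‖ₑ ^ 2 ∂ν := by
    rw [← lintegral_map (f := fun x : E => ‖x‖ₑ ^ 2) hm measurable_snd, Measure.map_snd_prod,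
      lintegral_smul_measure, smul_eq_mul]
  calc ∫⁻ z, ‖z.1 - z.2‖ₑ ^ 2 ∂(μ.prod ν)
      ≤ ∫⁻ z, 2 * (‖z.1‖ₑ ^ 2 + ‖z.2‖ₑ ^ 2) ∂(μ.prod ν) := lintegral_mono fun z => hpt z.1 z.2
    _ = 2 * (∫⁻ z, ‖z.1‖ₑ ^ 2 ∂(μ.prod ν) + ∫⁻ z, ‖z.2‖ₑ ^ 2 ∂(μ.prod ν)) := by
        rw [lintegral_const_mul' _ _ ENNReal.ofNat_ne_top,
          lintegral_add_left (f := fun z : E × E => ‖z.1‖ₑ ^ 2) (hm.comp measurable_fst)]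
    _ = _ := by rw [h1, h2]

/-- A coupling of `μ₁` and `ν₁` extends to one of `μ₁ + μ₂` and `ν₁ + ν₂` by coupling the
remainders, of equal mass, independently. -/
theorem exists_isCoupling_add {E : Type*} [NormedAddCommGroup E] [MeasurableSpace E]
    [BorelSpace E] [SecondCountableTopology E] {κ : Measure (E × E)} {μ₁ μ₂ ν₁ ν₂ : Measure E}
    [IsFiniteMeasure μ₂] [IsFiniteMeasure ν₂]
    (hκ : IsCoupling κ μ₁ ν₁) (hmass : μ₂ Set.univ = ν₂ Set.univ) :
    ∃ π, IsCoupling π (μ₁ + μ₂) (ν₁ + ν₂) ∧ ∫⁻ z, ‖z.1 - z.2‖ₑ ^ 2 ∂π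
      ≤ ∫⁻ z, ‖z.1 - z.2‖ₑ ^ 2 ∂κ + 2 * (∫⁻ x, ‖x‖ₑ ^ 2 ∂μ₂ + ∫⁻ y, ‖y‖ₑ ^ 2 ∂ν₂) := by
  have hc : ∀ ξ : Measure E, IsFiniteMeasure ξ → ((ξ Set.univ)⁻¹ * ξ Set.univ) • ξ = ξ := by
    intro ξ _
    -- for a null remainder the factor is `∞ * 0 = 0`, which is harmless
    by_cases h0 : ξ Set.univ = 0
    · rw [Measure.measure_univ_eq_zero.1 h0, smul_zero]
    · rw [ENNReal.inv_mul_cancel h0 (measure_ne_top _ _), one_smul]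
  refine ⟨κ + (μ₂ Set.univ)⁻¹ • μ₂.prod ν₂, ⟨?_, ?_⟩, ?_⟩
  · rw [Measure.map_add _ _ measurable_fst, hκ.1, Measure.map_smul, Measure.map_fst_prod,
      smul_smul, ← hmass, hc _ inferInstance]
  · rw [Measure.map_add _ _ measurable_snd, hκ.2, Measure.map_smul, Measure.map_snd_prod,
      smul_smul, hmass, hc _ inferInstance]
  · rw [lintegral_add_measure, lintegral_smul_measure]
    gcongr
    refine (mul_le_mul_right (lintegral_enorm_sub_sq_prod_le μ₂ ν₂) _).trans ?_
    rw [← hmass, ← mul_add, mul_left_comm, ← mul_assoc (μ₂ Set.univ)⁻¹]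
    gcongr
    exact mul_le_of_le_one_left' (ENNReal.inv_mul_le_one _)

/-- Keep on each cell `A i` the share `min (μ (A i)) (ν (A i))` of the mass of `μ`. The remainder
`μ₂` has mass `μ (A i) - ν (A i)`, truncated at `0`, on `A i`, and all of the mass of `μ` outside
the cells. -/
theorem exists_sum_restrict_add_eq {E : Type*} [NormedAddCommGroup E] [MeasurableSpace E]
    (μ ν : Measure E) [IsFiniteMeasure μ] {ι : Type*} (s : Finset ι)
    {A : ι → Set E} (hA : ∀ i, MeasurableSet (A i)) (hd : Pairwise (Function.onFun Disjoint A))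
    {R : ℝ≥0∞} (hR : ∀ i ∈ s, ∀ x ∈ A i, ‖x‖ₑ ≤ R) :
    ∃ μ₂ : Measure E,
      ∑ i ∈ s, (min (μ (A i)) (ν (A i)) * (μ (A i))⁻¹) • μ.restrict (A i) + μ₂ = μ ∧
      ∫⁻ x, ‖x‖ₑ ^ 2 ∂μ₂ ≤ R ^ 2 * ∑ i ∈ s, (μ (A i) - ν (A i))
        + ∫⁻ x in (⋃ i ∈ s, A i)ᶜ, ‖x‖ₑ ^ 2 ∂μ := by
  refine ⟨∑ i ∈ s, ((μ (A i) - ν (A i)) * (μ (A i))⁻¹) • μ.restrict (A i)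
    + μ.restrict (⋃ i ∈ s, A i)ᶜ, ?_, ?_⟩
  · have hU : MeasurableSet (⋃ i ∈ s, A i) := Finset.measurableSet_biUnion _ fun i _ => hA i
    have hi : ∀ i ∈ s, (min (μ (A i)) (ν (A i)) * (μ (A i))⁻¹) • μ.restrict (A i)
        + ((μ (A i) - ν (A i)) * (μ (A i))⁻¹) • μ.restrict (A i) = μ.restrict (A i) := by
      intro i _
      rw [← add_smul, ← add_mul, add_comm (min _ _), tsub_add_min]
      by_cases h0 : μ (A i) = 0
      · rw [Measure.restrict_eq_zero.2 h0, smul_zero]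
      · rw [ENNReal.mul_inv_cancel h0 (measure_ne_top _ _), one_smul]
    rw [← add_assoc, ← Finset.sum_add_distrib, Finset.sum_congr rfl hi]
    nth_rewrite 3 [← Measure.restrict_add_restrict_compl (μ := μ) hU]
    rw [Measure.restrict_biUnion_finset (fun i _ j _ hij => hd hij) hA, Measure.sum_fintype,
      Finset.sum_coe_sort s fun i => μ.restrict (A i)]
  · rw [lintegral_add_measure, lintegral_finsetSum_measure, Finset.mul_sum]
    gcongr with i hi
    rw [lintegral_smul_measure, smul_eq_mul]
    have h : ∫⁻ x in A i, ‖x‖ₑ ^ 2 ∂μ ≤ R ^ 2 * μ (A i) := by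
      rw [← setLIntegral_const]
      exact setLIntegral_mono' (hA i) fun x hx => by gcongr; exact hR i hi x hx
    calc _ ≤ (μ (A i) - ν (A i)) * (μ (A i))⁻¹ * (R ^ 2 * μ (A i)) := by gcongr
      _ = R ^ 2 * (μ (A i) - ν (A i)) * ((μ (A i))⁻¹ * μ (A i)) := by ring
      _ ≤ _ := mul_le_of_le_one_right' (ENNReal.inv_mul_le_one _)

/-- Couple the mass that `μ` and `ν` have in common on each cell within that cell, at a cost of at
most `η ^ 2`, and couple what remains independently. The truncated differences
`(μ (A i) - ν (A i)) + (ν (A i) - μ (A i))` stand for `|μ (A i) - ν (A i)|`. -/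
theorem exists_isCoupling_le_of_partition {E : Type*} [NormedAddCommGroup E] [MeasurableSpace E]
    [BorelSpace E] [SecondCountableTopology E]
    (μ ν : Measure E) [IsProbabilityMeasure μ] [IsProbabilityMeasure ν] {ι : Type*} (s : Finset ι)
    {A : ι → Set E} (hA : ∀ i, MeasurableSet (A i)) (hd : Pairwise (Function.onFun Disjoint A))
    {R η : ℝ≥0∞} (hR : ∀ i ∈ s, ∀ x ∈ A i, ‖x‖ₑ ≤ R)
    (hη : ∀ i ∈ s, ∀ x ∈ A i, ∀ y ∈ A i, ‖x - y‖ₑ ≤ η) :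
    ∃ π, IsCoupling π μ ν ∧ ∫⁻ z, ‖z.1 - z.2‖ₑ ^ 2 ∂π ≤ η ^ 2
      + 2 * (R ^ 2 * ∑ i ∈ s, ((μ (A i) - ν (A i)) + (ν (A i) - μ (A i)))
        + ((∫⁻ x in (⋃ i ∈ s, A i)ᶜ, ‖x‖ₑ ^ 2 ∂μ)
          + ∫⁻ x in (⋃ i ∈ s, A i)ᶜ, ‖x‖ₑ ^ 2 ∂ν)) := by
  obtain ⟨μ₂, hμ, hμ₂⟩ := exists_sum_restrict_add_eq μ ν s hA hd hR
  obtain ⟨ν₂, hν, hν₂⟩ := exists_sum_restrict_add_eq ν μ s hA hd hR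
  set μ₁ := ∑ i ∈ s, (min (μ (A i)) (ν (A i)) * (μ (A i))⁻¹) • μ.restrict (A i) with hμ₁
  set ν₁ := ∑ i ∈ s, (min (ν (A i)) (μ (A i)) * (ν (A i))⁻¹) • ν.restrict (A i) with hν₁
  have hmass : ∀ (ξ ζ : Measure E), IsProbabilityMeasure ξ → ∀ i,
      min (ξ (A i)) (ζ (A i)) * (ξ (A i))⁻¹ * ξ (A i) = min (ξ (A i)) (ζ (A i)) := by
    intro ξ ζ _ i
    by_cases h0 : ξ (A i) = 0
    · simp [h0]
    · rw [mul_assoc, ENNReal.inv_mul_cancel h0 (measure_ne_top _ _), mul_one]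
  have hμ₁u : μ₁ Set.univ = ∑ i ∈ s, min (μ (A i)) (ν (A i)) := by
    simp [hμ₁, hmass μ ν inferInstance]
  have hν₁u : ν₁ Set.univ = ∑ i ∈ s, min (μ (A i)) (ν (A i)) := by
    simp_rw [min_comm (μ _)]
    simp [hν₁, hmass ν μ inferInstance]
  have hle : ∑ i ∈ s, min (μ (A i)) (ν (A i)) ≤ 1 := by
    rw [← hμ₁u, ← measure_univ (μ := μ)]
    exact Measure.le_iff'.1 ((Measure.le_add_right le_rfl).trans hμ.le) _
  have hμ₂f : IsFiniteMeasure μ₂ := isFiniteMeasure_of_le μ (hμ ▸ Measure.le_add_left le_rfl)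
  have hν₂f : IsFiniteMeasure ν₂ := isFiniteMeasure_of_le ν (hν ▸ Measure.le_add_left le_rfl)
  have hmeq : μ₂ Set.univ = ν₂ Set.univ := by
    have h1 : μ₁ Set.univ + μ₂ Set.univ = 1 := by
      rw [← Measure.add_apply, hμ, measure_univ]
    have h2 : ν₁ Set.univ + ν₂ Set.univ = 1 := by
      rw [← Measure.add_apply, hν, measure_univ]
    rw [hμ₁u] at h1
    rw [hν₁u, ← h1] at h2
    exact ((ENNReal.add_right_inj (hle.trans_lt ENNReal.one_lt_top).ne).1 h2).symm
  set κ : Measure (E × E) := ∑ i ∈ s, (min (μ (A i)) (ν (A i)) * (μ (A i))⁻¹ * (ν (A i))⁻¹) •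
    (μ.restrict (A i)).prod (ν.restrict (A i)) with hκ
  have hκc : IsCoupling κ μ₁ ν₁ := by
    constructor
    · rw [hκ, Measure.map_finset_sum measurable_fst.aemeasurable, hμ₁]
      refine Finset.sum_congr rfl fun i _ => ?_
      rw [Measure.map_smul, Measure.map_fst_prod, smul_smul, Measure.restrict_apply_univ]
      congr 1
      rw [mul_right_comm _ _ (ν (A i))⁻¹, mul_right_comm _ _ (ν (A i)), min_comm,
        hmass ν μ inferInstance]
    · rw [hκ, Measure.map_finset_sum measurable_snd.aemeasurable, hν₁]
      refine Finset.sum_congr rfl fun i _ => ?_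
      rw [Measure.map_smul, Measure.map_snd_prod, smul_smul, Measure.restrict_apply_univ]
      congr 1
      rw [mul_right_comm _ _ (μ (A i)), hmass μ ν inferInstance, min_comm]
  have hκcost : ∫⁻ z, ‖z.1 - z.2‖ₑ ^ 2 ∂κ ≤ η ^ 2 := by
    rw [hκ, lintegral_finsetSum_measure]
    refine le_trans (Finset.sum_le_sum fun i hi => ?_)
      ((Finset.mul_sum s _ (η ^ 2)).symm.le.trans (mul_le_of_le_one_right' hle))
    rw [lintegral_smul_measure, smul_eq_mul, Measure.prod_restrict]
    have h : ∫⁻ z in A i ×ˢ A i, ‖z.1 - z.2‖ₑ ^ 2 ∂(μ.prod ν) ≤ η ^ 2 * (μ (A i) * ν (A i)) := by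
      rw [← Measure.prod_prod, ← setLIntegral_const]
      exact setLIntegral_mono' ((hA i).prod (hA i)) fun z hz => by
        gcongr; exact hη i hi _ hz.1 _ hz.2
    calc _ ≤ min (μ (A i)) (ν (A i)) * (μ (A i))⁻¹ * (ν (A i))⁻¹
            * (η ^ 2 * (μ (A i) * ν (A i))) := by gcongr
      _ = η ^ 2 * min (μ (A i)) (ν (A i)) * ((μ (A i))⁻¹ * μ (A i))
            * ((ν (A i))⁻¹ * ν (A i)) := by ring
      _ ≤ _ := (mul_le_of_le_one_right' (ENNReal.inv_mul_le_one _)).trans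
        (mul_le_of_le_one_right' (ENNReal.inv_mul_le_one _))
  obtain ⟨π, hπ, hπc⟩ := exists_isCoupling_add hκc hmeq
  rw [hμ, hν] at hπ
  refine ⟨π, hπ, hπc.trans ?_⟩
  calc _ ≤ η ^ 2 + 2 * ((R ^ 2 * ∑ i ∈ s, (μ (A i) - ν (A i))
        + ∫⁻ x in (⋃ i ∈ s, A i)ᶜ, ‖x‖ₑ ^ 2 ∂μ) + (R ^ 2 * ∑ i ∈ s, (ν (A i) - μ (A i))
        + ∫⁻ x in (⋃ i ∈ s, A i)ᶜ, ‖x‖ₑ ^ 2 ∂ν)) := by gcongr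
    _ = _ := by rw [Finset.sum_add_distrib]; ring

/-! ### Uniform integrability over compact sets -/

/-- Second moments are uniformly integrable over a compact set. This is Dini's argument for the
continuous functions `F ↦ ∫ max 0 (2 (‖x‖² - k)) dF`, which decrease to `0` as `k → ∞`; the factor
`2` makes the integrand at least `‖x‖²` where `‖x‖² ≥ 2 k`. -/
theorem exists_forall_lintegral_tail_le {E : Type*} [NormedAddCommGroup E] [MeasurableSpace E]
    [BorelSpace E] {Δ₀ : Set (FinVarDist E)} (hΔ₀ : IsCompact Δ₀)
    {η : ℝ} (hη : 0 < η) :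
    ∃ r : ℝ, ∀ F ∈ Δ₀, ∫⁻ x in {x : E | r < ‖x‖}, ‖x‖ₑ ^ 2 ∂F.toMeasure ≤ ENNReal.ofReal η := by
  let γ : ℕ → E → ℝ := fun k x => max 0 (2 * (‖x‖ ^ 2 - k))
  have hγc : ∀ k, Continuous (γ k) := fun k => by fun_prop
  have hγ0 : ∀ k x, 0 ≤ γ k x := fun k x => le_max_left _ _
  have hγle : ∀ k x, γ k x ≤ 2 * ‖x‖ ^ 2 := fun k x =>
    max_le (by positivity) (by have : (0 : ℝ) ≤ k := k.cast_nonneg; linarith)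
  have hint : ∀ (F : FinVarDist E) k, Integrable (γ k) F.toMeasure := fun F k =>
    (F.memLp_two.integrable_norm_pow two_ne_zero |>.const_mul 2).mono'
      (hγc k).measurable.aestronglyMeasurable
      (ae_of_all _ fun x => by rw [Real.norm_of_nonneg (hγ0 k x)]; exact hγle k x)
  let U : ℕ → Set (FinVarDist E) := fun k => {F | ∫ x, γ k x ∂F.toMeasure < η}
  have hUo : ∀ k, IsOpen (U k) := fun k => by
    have hq : ∃ C : ℝ, ∀ x, |γ k x| ≤ C * (1 + ‖x‖ ^ 2) :=
      ⟨2, fun x => by rw [abs_of_nonneg (hγ0 k x)]; linarith [hγle k x]⟩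
    have hcont : Continuous fun F : FinVarDist E => ∫ x, γ k x ∂F.toMeasure :=
      (continuous_apply (A := fun _ : QuadGrowth E => ℝ) ⟨γ k, hγc k, hq⟩).comp
        (continuous_induced_dom
          (f := fun (F : FinVarDist E) (γ : QuadGrowth E) => ∫ x, γ.1 x ∂F.toMeasure))
    exact isOpen_lt hcont continuous_const
  have hmono : Monotone U := fun k l hkl F (hF : ∫ x, γ k x ∂F.toMeasure < η) => by
    change ∫ x, γ l x ∂F.toMeasure < η
    refine lt_of_le_of_lt (integral_mono (hint F l) (hint F k) fun x => ?_) hF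
    have : (k : ℝ) ≤ l := by exact_mod_cast hkl
    exact max_le_max le_rfl (by linarith)
  have hcov : Δ₀ ⊆ ⋃ k, U k := fun F _ => by
    have hlim : Tendsto (fun k => ∫ x, γ k x ∂F.toMeasure) atTop (𝓝 (∫ _, (0 : ℝ) ∂F.toMeasure)) :=
      tendsto_integral_of_dominated_convergence (fun x => 2 * ‖x‖ ^ 2)
        (fun k => (hint F k).aestronglyMeasurable)
        (F.memLp_two.integrable_norm_pow two_ne_zero |>.const_mul 2)
        (fun k => ae_of_all _ fun x => by
          rw [Real.norm_of_nonneg (hγ0 k x)]; exact hγle k x)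
        (ae_of_all _ fun x => by
          obtain ⟨K, hK⟩ := exists_nat_ge (‖x‖ ^ 2)
          refine tendsto_const_nhds.congr' ?_
          filter_upwards [eventually_ge_atTop K] with k hk
          have : (K : ℝ) ≤ k := by exact_mod_cast hk
          exact (max_eq_left (by linarith)).symm)
    rw [integral_zero] at hlim
    obtain ⟨k, hk⟩ := (hlim.eventually_lt_const hη).exists
    exact Set.mem_iUnion.2 ⟨k, hk⟩
  obtain ⟨k, hk⟩ := hΔ₀.elim_directed_cover U hUo hcov hmono.directed_le
  refine ⟨√(2 * k), fun F hF => ?_⟩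
  have hm : MeasurableSet {x : E | √(2 * k) < ‖x‖} :=
    (isOpen_lt continuous_const continuous_norm).measurableSet
  calc ∫⁻ x in {x : E | √(2 * k) < ‖x‖}, ‖x‖ₑ ^ 2 ∂F.toMeasure
      ≤ ∫⁻ x in {x : E | √(2 * k) < ‖x‖}, ENNReal.ofReal (γ k x) ∂F.toMeasure := by
        refine setLIntegral_mono' hm fun x (hx : √(2 * k) < ‖x‖) => ?_
        rw [← ofReal_norm, ← ENNReal.ofReal_pow (norm_nonneg _)]
        refine ENNReal.ofReal_le_ofReal (le_max_of_le_right ?_)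
        have := (Real.sqrt_lt' (lt_of_le_of_lt (Real.sqrt_nonneg _) hx)).1 hx
        linarith
    _ ≤ ∫⁻ x, ENNReal.ofReal (γ k x) ∂F.toMeasure := setLIntegral_le_lintegral _ _
    _ = ENNReal.ofReal (∫ x, γ k x ∂F.toMeasure) :=
        (ofReal_integral_eq_lintegral_ofReal (hint F k) (ae_of_all _ (hγ0 k))).symm
    _ ≤ _ := ENNReal.ofReal_le_ofReal (hk hF).le

/-! ### Moments of the empirical distribution -/

theorem lintegral_empiricalDist {E : Type*} [MeasurableSpace E] {n : ℕ} (x : Fin n → E)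
    {f : E → ℝ≥0∞} (hf : Measurable f) :
    ∫⁻ y, f y ∂empiricalDist x = (n : ℝ≥0∞)⁻¹ * ∑ i, f (x i) := by
  simp [empiricalDist, lintegral_finsetSum_measure, lintegral_dirac' _ hf]

theorem isProbabilityMeasure_empiricalDist {E : Type*} [MeasurableSpace E] {n : ℕ} (hn : n ≠ 0)
    (x : Fin n → E) : IsProbabilityMeasure (empiricalDist x) :=
  ⟨by simp [empiricalDist, ENNReal.inv_mul_cancel (Nat.cast_ne_zero.2 hn)
    (ENNReal.natCast_ne_top n)]⟩

theorem measurable_lintegral_empiricalDist {E Ω : Type*} [MeasurableSpace E] [MeasurableSpace Ω]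
    {n : ℕ} {X : Fin n → Ω → E} (hX : ∀ i, Measurable (X i)) {f : E → ℝ≥0∞} (hf : Measurable f) :
    Measurable fun ω => ∫⁻ y, f y ∂(empiricalDist fun i => X i ω) := by
  simp_rw [lintegral_empiricalDist _ hf]
  exact (Finset.measurable_sum _ fun i _ => hf.comp (hX i)).const_mul _

theorem measurable_empiricalDist_apply {E Ω : Type*} [MeasurableSpace E] [MeasurableSpace Ω]
    {n : ℕ} {X : Fin n → Ω → E} (hX : ∀ i, Measurable (X i)) {A : Set E} (hA : MeasurableSet A) :
    Measurable fun ω => empiricalDist (fun i => X i ω) A := by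
  simpa [lintegral_indicator_one hA] using
    measurable_lintegral_empiricalDist hX (measurable_one.indicator hA)

theorem lintegral_lintegral_empiricalDist {E Ω : Type*} [MeasurableSpace E] [MeasurableSpace Ω]
    {P : Measure Ω} {μ : Measure E} {n : ℕ} (hn : n ≠ 0) {X : Fin n → Ω → E}
    (hX : ∀ i, Measurable (X i)) (hlaw : ∀ i, P.map (X i) = μ) {f : E → ℝ≥0∞}
    (hf : Measurable f) :
    ∫⁻ ω, ∫⁻ y, f y ∂(empiricalDist fun i => X i ω) ∂P = ∫⁻ y, f y ∂μ := by
  have hfX : ∀ i, Measurable fun ω => f (X i ω) := fun i => hf.comp (hX i)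
  simp_rw [lintegral_empiricalDist _ hf]
  rw [lintegral_const_mul _ (Finset.measurable_sum _ fun i _ => hfX i),
    lintegral_finsetSum _ fun i _ => hfX i]
  simp_rw [← lintegral_map hf (hX _), hlaw]
  rw [Finset.sum_const, Finset.card_univ, Fintype.card_fin, nsmul_eq_mul, ← mul_assoc,
    ENNReal.inv_mul_cancel (Nat.cast_ne_zero.2 hn) (ENNReal.natCast_ne_top n), one_mul]

/-- The expected deviation `E |μ(A) - μ̂ₙ(A)|` is of order `n ^ (-1/2)`, uniformly in `μ` and `A`.
The two truncated differences add up to the absolute value of the difference. -/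
theorem lintegral_empiricalDist_deviation_le {E Ω : Type*} [MeasurableSpace E] [MeasurableSpace Ω]
    {P : Measure Ω} [IsProbabilityMeasure P] {μ : Measure E} [IsProbabilityMeasure μ] {n : ℕ}
    (hn : n ≠ 0) {X : Fin n → Ω → E} (hX : ∀ i, Measurable (X i)) (hindep : iIndepFun X P)
    (hlaw : ∀ i, P.map (X i) = μ) {A : Set E} (hA : MeasurableSet A) :
    ∫⁻ ω, ((μ A - empiricalDist (fun i => X i ω) A)
      + (empiricalDist (fun i => X i ω) A - μ A)) ∂P ≤ ENNReal.ofReal (2 / √n) := by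
  have hn0 : (0 : ℝ) < n := by exact_mod_cast Nat.pos_of_ne_zero hn
  let Y : Fin n → Ω → ℝ := fun i ω => A.indicator (fun _ => (1 : ℝ)) (X i ω)
  have hind : Measurable (A.indicator fun _ : E => (1 : ℝ)) := measurable_const.indicator hA
  have hYb : ∀ i ω, Y i ω ∈ Set.Icc (0 : ℝ) 1 := fun i ω => by
    by_cases h : X i ω ∈ A <;> simp [Y, h]
  have hY : ∀ i, MemLp (Y i) 2 P := fun i =>
    memLp_of_bounded (ae_of_all _ (hYb i)) (hind.comp (hX i)).aestronglyMeasurable 2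
  have hYint : ∀ i, ∫ ω, Y i ω ∂P = μ.real A := fun i => by
    rw [← integral_map (φ := X i) (f := A.indicator fun _ => (1 : ℝ)) (hX i).aemeasurable
      hind.aestronglyMeasurable, hlaw, integral_indicator hA]
    simp
  have hvar : Var[∑ i, Y i; P] ≤ n := by
    rw [IndepFun.variance_sum (fun i _ => hY i) fun i _ j _ hij =>
      (hindep.indepFun hij).comp hind hind]
    refine (Finset.sum_le_sum fun i _ =>
      variance_le_sq_of_bounded (ae_of_all _ (hYb i)) (hind.comp (hX i)).aemeasurable).trans ?_
    norm_num
    linarith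
  let Z : Ω → ℝ := fun ω => (n : ℝ)⁻¹ * ∑ i, Y i ω - μ.real A
  have hS : MemLp (∑ i, Y i) 2 P := memLp_finsetSum' _ fun i _ => hY i
  have hZ : MemLp Z 2 P := by
    have := (hS.const_mul (n : ℝ)⁻¹).sub (memLp_const (μ.real A))
    convert this using 1
    ext ω; simp [Z]
  have hZsq : ∫ ω, Z ω ^ 2 ∂P ≤ 1 / n := by
    have hmean : ∫ ω, (∑ i, Y i) ω ∂P = n * μ.real A := by
      simp_rw [Finset.sum_apply]
      rw [integral_finsetSum _ fun i _ => (hY i).integrable one_le_two]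
      simp [hYint]
    have h : ∀ ω, Z ω ^ 2 = ((n : ℝ)⁻¹) ^ 2 * ((∑ i, Y i) ω - n * μ.real A) ^ 2 := fun ω => by
      simp only [Z, Finset.sum_apply]
      field_simp
    simp_rw [h]
    rw [integral_const_mul, ← hmean, ← variance_eq_integral hS.aemeasurable]
    calc _ ≤ ((n : ℝ)⁻¹) ^ 2 * n := by gcongr
      _ = 1 / n := by field_simp
  have hreal : ∀ ω, empiricalDist (fun i => X i ω) A
      = ENNReal.ofReal ((n : ℝ)⁻¹ * ∑ i, Y i ω) := fun ω => by
    rw [ENNReal.ofReal_mul (by positivity), ENNReal.ofReal_inv_of_pos hn0,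
      ENNReal.ofReal_natCast, ENNReal.ofReal_sum_of_nonneg fun i _ => (hYb i ω).1]
    simp only [empiricalDist, Measure.smul_apply, Measure.finsetSum_apply, smul_eq_mul]
    congr 1
    refine Finset.sum_congr rfl fun i _ => ?_
    rw [Measure.dirac_apply' _ hA]
    by_cases h : X i ω ∈ A <;> simp [Y, h]
  have hs : 0 < √(n : ℝ) := Real.sqrt_pos.2 hn0
  have hpt : ∀ ω, (μ A - empiricalDist (fun i => X i ω) A)
      + (empiricalDist (fun i => X i ω) A - μ A)
      ≤ ENNReal.ofReal (1 / √n + √n * Z ω ^ 2) := fun ω => by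
    have h0 : 0 ≤ (n : ℝ)⁻¹ * ∑ i, Y i ω :=
      mul_nonneg (by positivity) (Finset.sum_nonneg fun i _ => (hYb i ω).1)
    -- the inequality of arithmetic and geometric means, balanced for `E Z² ≤ 1 / n`
    have hle : |Z ω| ≤ 1 / √n + √n * Z ω ^ 2 := by
      rw [← sq_abs (Z ω)]
      have : 0 ≤ (1 - √n * |Z ω|) ^ 2 / √n + |Z ω| := by positivity
      have h2 : (1 - √n * |Z ω|) ^ 2 / √n + |Z ω| = 1 / √n + √n * |Z ω| ^ 2 - |Z ω| := by
        field_simp; ring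
      linarith
    refine le_trans ?_ (ENNReal.ofReal_le_ofReal hle)
    rw [hreal ω, ← ofReal_measureReal (μ := μ) (s := A), ← ENNReal.ofReal_sub _ h0,
      ← ENNReal.ofReal_sub _ measureReal_nonneg]
    change ENNReal.ofReal (_ - _) + ENNReal.ofReal (Z ω) ≤ _
    rcases le_total 0 (Z ω) with h | h
    · rw [ENNReal.ofReal_of_nonpos (by simp only [Z] at h; linarith), zero_add, abs_of_nonneg h]
    · rw [ENNReal.ofReal_of_nonpos h, add_zero, abs_of_nonpos h]
      exact ENNReal.ofReal_le_ofReal (by simp only [Z]; linarith)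
  calc _ ≤ ∫⁻ ω, ENNReal.ofReal (1 / √n + √n * Z ω ^ 2) ∂P := lintegral_mono hpt
    _ = ENNReal.ofReal (∫ ω, (1 / √n + √n * Z ω ^ 2) ∂P) :=
        (ofReal_integral_eq_lintegral_ofReal
          ((integrable_const _).add (hZ.integrable_sq.const_mul _))
          (ae_of_all _ fun ω => show (0 : ℝ) ≤ 1 / √n + √n * Z ω ^ 2 by positivity)).symm
    _ ≤ _ := by
        refine ENNReal.ofReal_le_ofReal ?_
        rw [integral_add (integrable_const _) (hZ.integrable_sq.const_mul _), integral_const_mul]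
        have h1 : √n * ∫ ω, Z ω ^ 2 ∂P ≤ √n * (1 / n) := by gcongr
        have h2 : √(n : ℝ) * (1 / n) = 1 / √n := by
          nth_rewrite 2 [← Real.mul_self_sqrt hn0.le]
          field_simp
        have h3 : 2 / √(n : ℝ) = 1 / √n + 1 / √n := by ring
        simp only [integral_const, probReal_univ, one_smul]
        linarith

/-! ### Convergence of the empirical distribution -/

/-- Finitely many disjoint Borel sets of diameter at most `η` that partition a closed ball: the
finite subcover of the ball by balls of radius `η / 2`, intersected with the ball and disjointed. -/
theorem exists_partition_closedBall {E : Type*} [NormedAddCommGroup E] [ProperSpace E]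
    [MeasurableSpace E] [BorelSpace E] (r : ℝ) {η : ℝ} (hη : 0 < η) :
    ∃ (N : ℕ) (A : ℕ → Set E), (∀ i, MeasurableSet (A i)) ∧
      Pairwise (Function.onFun Disjoint A) ∧
      (⋃ i ∈ Finset.range N, A i)ᶜ ⊆ {x : E | r < ‖x‖} ∧
      (∀ i, ∀ x ∈ A i, ‖x‖ ≤ r) ∧ ∀ i, ∀ x ∈ A i, ∀ y ∈ A i, ‖x - y‖ ≤ η := by
  let d := TopologicalSpace.denseSeq E
  let U : ℕ → Set E := fun i => Metric.ball (d i) (η / 2) ∩ Metric.closedBall 0 r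
  have hcov : Metric.closedBall (0 : E) r ⊆ ⋃ i, Metric.ball (d i) (η / 2) := fun x _ => by
    obtain ⟨i, hi⟩ := (TopologicalSpace.denseRange_denseSeq E).exists_dist_lt x (half_pos hη)
    exact Set.mem_iUnion.2 ⟨i, hi⟩
  obtain ⟨t, ht⟩ := (isCompact_closedBall (0 : E) r).elim_finite_subcover _
    (fun i => Metric.isOpen_ball) hcov
  obtain ⟨N, hN⟩ := t.exists_nat_subset_range
  have hsub : ∀ i, disjointed U i ⊆ U i := disjointed_subset U
  refine ⟨N, disjointed U, MeasurableSet.disjointed fun i =>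
    measurableSet_ball.inter measurableSet_closedBall, disjoint_disjointed U, ?_, ?_, ?_⟩
  · rw [Set.compl_subset_comm]
    intro x hx
    have hxr : x ∈ Metric.closedBall (0 : E) r := by simpa using hx
    obtain ⟨i, hi, hxi⟩ := Set.mem_iUnion₂.1 (ht hxr)
    have hex : ∃ j, x ∈ U j := ⟨i, hxi, hxr⟩
    classical
    -- `x` lies in the disjointed piece of the first ball that contains it
    refine Set.mem_iUnion₂.2 ⟨Nat.find hex, Finset.mem_range.2
      ((Nat.find_min' hex ⟨hxi, hxr⟩).trans_lt (Finset.mem_range.1 (hN hi))), ?_⟩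
    rw [disjointed_apply]
    refine ⟨Nat.find_spec hex, fun hx' => ?_⟩
    simp only [Finset.sup_eq_iSup, Set.iSup_eq_iUnion, Set.mem_iUnion, Finset.mem_Iio] at hx'
    obtain ⟨j, hj, hxj⟩ := hx'
    exact Nat.find_min hex hj hxj
  · intro i x hx
    simpa using (hsub i hx).2
  · intro i x hx y hy
    rw [← dist_eq_norm]
    have h1 := Metric.mem_ball.1 (hsub i hx).1
    have h2 := Metric.mem_ball'.1 (hsub i hy).1
    linarith [dist_triangle x (d i) y]

/-- For large `n`, the optimal transport cost between `Fₙ` and the empirical distribution is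
dominated by a random variable of small expectation. The dominating `B` is measurable, whereas
measurability of the transport cost itself as a function of `ω` is never needed. -/
theorem eventually_exists_isCoupling_empiricalDist {E : Type*} [NormedAddCommGroup E]
    [ProperSpace E] [MeasurableSpace E] [BorelSpace E]
    {Δ₀ : Set (FinVarDist E)} (hΔ₀ : IsCompact Δ₀) {F : ℕ → FinVarDist E} (hF : ∀ n, F n ∈ Δ₀)
    {Ω : ℕ → Type*} [∀ n, MeasurableSpace (Ω n)]
    (P : ∀ n, Measure (Ω n)) [∀ n, IsProbabilityMeasure (P n)] {X : ∀ n, Fin n → Ω n → E}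
    (hX : ∀ n i, Measurable (X n i)) (hindep : ∀ n, iIndepFun (X n) (P n))
    (hlaw : ∀ n i, (P n).map (X n i) = (F n).toMeasure) {θ : ℝ} (hθ : 0 < θ) :
    ∀ᶠ n in atTop, ∃ B : Ω n → ℝ≥0∞, Measurable B ∧ ∫⁻ ω, B ω ∂(P n) ≤ ENNReal.ofReal θ ∧
      ∀ ω, ∃ π, IsCoupling π (F n).toMeasure (empiricalDist fun i => X n i ω) ∧
        ∫⁻ z, ‖z.1 - z.2‖ₑ ^ 2 ∂π ≤ B ω := by
  -- the diameter of the cells contributes `θ / 4`, the two tails `2 * (θ / 8 + θ / 8) = θ / 2`, and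
  -- the deviations of the cell masses, which tend to `0`, the last `θ / 4`
  obtain ⟨r, hr⟩ := exists_forall_lintegral_tail_le hΔ₀ (η := θ / 8) (by positivity)
  obtain ⟨N, A, hA, hd, hcov, hAr, hAη⟩ :=
    exists_partition_closedBall (E := E) r (η := √(θ / 4)) (by positivity)
  have hlim : Tendsto (fun n : ℕ => 2 * (r ^ 2 * (N * (2 / √(n : ℝ))))) atTop (𝓝 0) := by
    have h : Tendsto (fun n : ℕ => 2 / √(n : ℝ)) atTop (𝓝 0) :=
      tendsto_const_nhds.div_atTop (Real.tendsto_sqrt_atTop.comp tendsto_natCast_atTop_atTop)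
    simpa using ((h.const_mul (N : ℝ)).const_mul (r ^ 2)).const_mul 2
  filter_upwards [eventually_ne_atTop 0, hlim.eventually_lt_const (show 0 < θ / 4 by positivity)]
    with n hn hnθ
  have hμ : IsProbabilityMeasure (F n).toMeasure := (F n).isProbabilityMeasure
  let T : Set E := {x : E | r < ‖x‖}
  have hT : MeasurableSet T := (isOpen_lt continuous_const continuous_norm).measurableSet
  let f : E → ℝ≥0∞ := T.indicator fun x => ‖x‖ₑ ^ 2
  have hf : Measurable f := Measurable.indicator (by fun_prop) hT
  let D : ℕ → Ω n → ℝ≥0∞ := fun i ω =>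
    ((F n).toMeasure (A i) - empiricalDist (fun i => X n i ω) (A i))
      + (empiricalDist (fun i => X n i ω) (A i) - (F n).toMeasure (A i))
  have hD : ∀ i, Measurable (D i) := fun i =>
    (measurable_const.sub (measurable_empiricalDist_apply (hX n) (hA i))).add
      ((measurable_empiricalDist_apply (hX n) (hA i)).sub measurable_const)
  have hG : Measurable fun ω => ∫⁻ y, f y ∂(empiricalDist fun i => X n i ω) :=
    measurable_lintegral_empiricalDist (hX n) hf
  have hS : Measurable fun ω => ∑ i ∈ Finset.range N, D i ω :=
    Finset.measurable_sum _ fun i _ => hD i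
  have htail : ∫⁻ x, f x ∂(F n).toMeasure ≤ ENNReal.ofReal (θ / 8) := by
    rw [lintegral_indicator hT]; exact hr _ (hF n)
  refine ⟨fun ω => ENNReal.ofReal √(θ / 4) ^ 2
    + 2 * (ENNReal.ofReal |r| ^ 2 * ∑ i ∈ Finset.range N, D i ω
      + (∫⁻ x, f x ∂(F n).toMeasure + ∫⁻ y, f y ∂(empiricalDist fun i => X n i ω))),
    (((hS.const_mul _).add (hG.const_add _)).const_mul _).const_add _, ?_, fun ω => ?_⟩
  · rw [lintegral_add_left measurable_const, lintegral_const_mul' _ _ ENNReal.ofNat_ne_top,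
      lintegral_add_left (hS.const_mul _), lintegral_const_mul _ hS,
      lintegral_finsetSum _ fun i _ => hD i, lintegral_add_left measurable_const,
      lintegral_lintegral_empiricalDist hn (hX n) (hlaw n) hf]
    simp only [lintegral_const, measure_univ, mul_one]
    calc _ ≤ ENNReal.ofReal √(θ / 4) ^ 2 + 2 * (ENNReal.ofReal |r| ^ 2 *
            ∑ i ∈ Finset.range N, ENNReal.ofReal (2 / √n)
              + (ENNReal.ofReal (θ / 8) + ENNReal.ofReal (θ / 8))) := by
          gcongr with i _
          exact lintegral_empiricalDist_deviation_le hn (hX n) (hindep n) (hlaw n) (hA i)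
      _ = ENNReal.ofReal (√(θ / 4) ^ 2
            + 2 * (|r| ^ 2 * (N * (2 / √n)) + (θ / 8 + θ / 8))) := by
          rw [Finset.sum_const, Finset.card_range, nsmul_eq_mul, ← ENNReal.ofReal_natCast,
            ← ENNReal.ofReal_ofNat]
          repeat rw [ENNReal.ofReal_add (by positivity) (by positivity)]
          repeat rw [ENNReal.ofReal_mul (by positivity)]
          repeat rw [ENNReal.ofReal_add (by positivity) (by positivity)]
          repeat rw [ENNReal.ofReal_mul (by positivity)]
          rw [ENNReal.ofReal_pow (by positivity), ENNReal.ofReal_pow (by positivity)]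
      _ ≤ _ := by
          refine ENNReal.ofReal_le_ofReal ?_
          rw [Real.sq_sqrt (by positivity), sq_abs]
          linarith
  · have hν := isProbabilityMeasure_empiricalDist hn fun i => X n i ω
    have hcomp : ∀ ξ : Measure E,
        ∫⁻ x in (⋃ i ∈ Finset.range N, A i)ᶜ, ‖x‖ₑ ^ 2 ∂ξ ≤ ∫⁻ x, f x ∂ξ := fun ξ => by
      rw [lintegral_indicator hT]
      exact lintegral_mono_set hcov
    obtain ⟨π, hπ, hcost⟩ := exists_isCoupling_le_of_partition (F n).toMeasure
      (empiricalDist fun i => X n i ω) (Finset.range N) hA hd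
      (R := ENNReal.ofReal |r|) (η := ENNReal.ofReal √(θ / 4))
      (fun i _ x hx => by
        rw [← ofReal_norm]
        exact ENNReal.ofReal_le_ofReal ((hAr i x hx).trans (le_abs_self r)))
      (fun i _ x hx y hy => by
        rw [← ofReal_norm]
        exact ENNReal.ofReal_le_ofReal (hAη i x hx y hy))
    refine ⟨π, hπ, hcost.trans ?_⟩
    exact add_le_add le_rfl (mul_le_mul' le_rfl
      (add_le_add le_rfl (add_le_add (hcomp _) (hcomp _))))

/-! ### Convergence of the bootstrap law -/

theorem theorem3 {E : Type*} [NormedAddCommGroup E] [InnerProductSpace ℝ E]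
    [FiniteDimensional ℝ E] [MeasurableSpace E] [BorelSpace E]
    (Δ₀ : Set (FinVarDist E)) (hΔ₀ : IsCompact Δ₀)
    (F : ℕ → FinVarDist E) (hF : ∀ n, F n ∈ Δ₀)
    {Ω : ℕ → Type*} [∀ n, MeasurableSpace (Ω n)]
    (P : ∀ n, Measure (Ω n)) [∀ n, IsProbabilityMeasure (P n)]
    (X : ∀ n, Fin n → Ω n → E)
    (hXmeas : ∀ n i, Measurable (X n i))
    (hXindep : ∀ n, iIndepFun (X n) (P n))
    (hXlaw : ∀ n i, (P n).map (X n i) = (F n).toMeasure)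
    (δ : ℝ) (m : ∀ n, Fin n → ℝ)
    (hmean : ∀ n, ∑ i, m n i = 0)
    (hsq : ∀ n, ∑ i, (m n i) ^ 2 ≤ δ ^ 2) :
    ∀ ε : ℝ, 0 < ε →
      Tendsto
        (fun n => P n {ω | ENNReal.ofReal ε ≤
          rho2 ((P n).map fun ω' => ∑ i, m n i • X n i ω')
            (bootstrapLaw (m n) fun i => X n i ω)})
        atTop (𝓝 0) := by
  intro ε hε
  have hprop : ProperSpace E := FiniteDimensional.proper_real E
  -- `δ` may be `0`; enlarging `δ ^ 2` to `δ ^ 2 + 1` makes it possible to divide by it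
  have hδ : 0 < √(δ ^ 2 + 1) ^ 2 := by positivity
  have hδle : δ ^ 2 ≤ √(δ ^ 2 + 1) ^ 2 := by rw [Real.sq_sqrt (by positivity)]; linarith
  set c : ℝ := ε ^ 2 / √(δ ^ 2 + 1) ^ 2 with hc
  have hc0 : 0 < c := by positivity
  rw [ENNReal.tendsto_nhds_zero]
  intro τ hτ
  obtain ⟨t, ht0, htτ⟩ := ENNReal.lt_iff_exists_nnreal_btwn.1 hτ
  have ht0' : (0 : ℝ) < t := by exact_mod_cast ht0
  filter_upwards [eventually_ne_atTop 0, eventually_exists_isCoupling_empiricalDist hΔ₀ hF P hXmeas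
    hXindep hXlaw (mul_pos ht0' hc0)] with n hn ⟨B, hB, hBint, hBπ⟩
  have hμ : IsProbabilityMeasure (F n).toMeasure := (F n).isProbabilityMeasure
  have hsub : {ω | ENNReal.ofReal ε ≤ rho2 ((P n).map fun ω' => ∑ i, m n i • X n i ω')
      (bootstrapLaw (m n) fun i => X n i ω)} ⊆ {ω | ENNReal.ofReal c ≤ B ω} := by
    intro ω (hω : ENNReal.ofReal ε ≤ _)
    have hν := isProbabilityMeasure_empiricalDist hn fun i => X n i ω
    obtain ⟨π, hπ, hcost⟩ := hBπ ω
    -- if the cost is infinite then so is `B ω`, and `ω` lies in the larger event anyway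
    by_cases hfin : ∫⁻ z, ‖z.1 - z.2‖ₑ ^ 2 ∂π = ∞
    · exact le_top.trans (hfin ▸ hcost)
    have hlawsum : (P n).map (fun ω' => ∑ i, m n i • X n i ω')
        = (Measure.pi fun _ : Fin n => (F n).toMeasure).map fun y => ∑ i, m n i • y i := by
      have h := (iIndepFun_iff_map_fun_eq_pi_map fun i => (hXmeas n i).aemeasurable).1 (hXindep n)
      simp_rw [hXlaw] at h
      have hS : Measurable fun y : Fin n → E => ∑ i, m n i • y i :=
        Finset.measurable_sum _ fun i _ => (measurable_pi_apply i).const_smul (m n i)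
      rw [← h, Measure.map_map hS (measurable_pi_lambda _ (hXmeas n))]
      rfl
    have hkey := rho2_map_sum_smul_sq_le hπ hfin (hmean n) ((hsq n).trans hδle)
    rw [← hlawsum] at hkey
    change ENNReal.ofReal c ≤ B ω
    rw [hc, ENNReal.ofReal_div_of_pos hδ, ENNReal.ofReal_pow hε.le]
    refine ENNReal.div_le_of_le_mul' ?_
    calc ENNReal.ofReal ε ^ 2 ≤ _ := by gcongr; exact hω
      _ ≤ _ := hkey
      _ ≤ _ := by gcongr
  calc _ ≤ P n {ω | ENNReal.ofReal c ≤ B ω} := measure_mono hsub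
    _ ≤ (∫⁻ ω, B ω ∂(P n)) / ENNReal.ofReal c :=
        meas_ge_le_lintegral_div hB.aemeasurable (ENNReal.ofReal_pos.2 hc0).ne'
          ENNReal.ofReal_ne_top
    _ ≤ ENNReal.ofReal (t * c) / ENNReal.ofReal c := by gcongr
    _ = t := by
        rw [← ENNReal.ofReal_div_of_pos hc0, mul_div_cancel_right₀ _ hc0.ne',
          ENNReal.ofReal_coe_nnreal]
    _ ≤ τ := htτ.le
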